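/- For a finite simple graph $G$ let $\mathrm{MAD}(G)=\max_{H}\frac{2|E(H)|}{|V(H)|}$, where $H$ ranges over the subgraphs of $G$ with at least one vertex, denote its maximum average degree. An orientation of $G$ is proper if any two adjacent vertices of $G$ have different outdegrees, and the proper chromatic number $\vec{\chi}(G)$ is the minimum, over all proper orientations of $G$, of the largest outdegree of a vertex. Then $\vec{\chi}(G)=O\bigl(\frac{d\log d}{\log\log d}\bigr)$ for $d=\mathrm{MAD}(G)$; that is, there is an absolute constant $C>0$ such that every finite simple graph $G$ with $d=\mathrm{MAD}(G)>e$ (so that $\log\log d>0$) has a proper orientation and satisfies $$\vec{\chi}(G)\le C\,\frac{d\log d}{\log\log d}.$$ -/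

import Mathlib

/-- The outdegree of a vertex `v` in a digraph `D`: the number of arcs leaving `v`. -/
noncomputable def Digraph.outdegree {V : Type*} (D : Digraph V) (v : V) : ℕ∞ :=
  {w : V | D.Adj v w}.encard

namespace SimpleGraph

/-- The digraph `D` is an orientation of the graph `G`: every arc of `D` lies on an edge of `G`,
and every edge of `G` carries exactly one of its two possible directions. -/
structure IsOrientation {V : Type*} (G : SimpleGraph V) (D : Digraph V) : Prop where
  adj_of_adj : ∀ u v : V, D.Adj u v → G.Adj u v
  adj_iff_not_adj : ∀ u v : V, G.Adj u v → (D.Adj u v ↔ ¬ D.Adj v u)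

/-- An orientation is proper if any two adjacent vertices have different outdegrees. -/
structure IsProperOrientation {V : Type*} (G : SimpleGraph V) (D : Digraph V) : Prop extends
    G.IsOrientation D where
  outdegree_ne : ∀ u v : V, G.Adj u v → D.outdegree u ≠ D.outdegree v

/-- The proper chromatic number of `G`: the minimum, over all proper orientations of `G`, of the
largest outdegree. The value is `⊤` if there is no proper orientation of finite maximum outdegree
(the infimum over the empty family is `⊤`, not `0`). -/
noncomputable def properChromaticNumber {V : Type*} (G : SimpleGraph V) : ℕ∞ :=
  ⨅ (D : Digraph V) (_ : G.IsProperOrientation D), ⨆ v : V, D.outdegree v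

/-- The average degrees `2|E(H)| / |V(H)|` of the nonempty subgraphs `H` of `G`. -/
def subgraphAverageDegrees {V : Type*} (G : SimpleGraph V) : Set ℝ :=
  {x : ℝ | ∃ H : G.Subgraph, H.verts.Nonempty ∧
    x = 2 * (H.edgeSet.ncard : ℝ) / (H.verts.ncard : ℝ)}

/-- The maximum average degree of a finite graph: the largest average degree of its nonempty
subgraphs (`0` for the graph without vertices). -/
noncomputable def maxAverageDegree {V : Type*} (G : SimpleGraph V) : ℝ :=
  sSup G.subgraphAverageDegrees

/-- On a finite nonempty vertex set the supremum in `maxAverageDegree` is a maximum. -/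
theorem isGreatest_maxAverageDegree {V : Type*} [Finite V] [Nonempty V] (G : SimpleGraph V) :
    IsGreatest G.subgraphAverageDegrees G.maxAverageDegree := by
  have hfin : G.subgraphAverageDegrees.Finite := by
    refine (Set.finite_range fun H : G.Subgraph =>
      2 * (H.edgeSet.ncard : ℝ) / (H.verts.ncard : ℝ)).subset ?_
    rintro x ⟨H, -, rfl⟩
    exact ⟨H, rfl⟩
  have hne : G.subgraphAverageDegrees.Nonempty :=
    ⟨_, (⊤ : G.Subgraph), Set.univ_nonempty, rfl⟩
  exact ⟨hne.csSup_mem hfin, fun x hx => le_csSup hfin.bddAbove hx⟩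

end SimpleGraph

/-! The proof gives a linear bound. With `δ = ⌊d⌋₊` the graph is `δ`-degenerate: an order `π` leaves
each vertex at most `δ` earlier neighbours, so `r = δ + 1` colours suffice.

Initially every edge is undecided and counts towards the potential outdegree of both ends. Levels
`t` are treated in decreasing order; at level `t` an independent set receives outdegree exactly `t`.
Vertices fixed before have larger outdegree, so properness is automatic. Surplus arcs are reversed
only along edges to later vertices. Hence forced out-arcs always go to earlier vertices, and only
the at most `δ` arcs to earlier neighbours are unavailable for reversal.

One level per colour class first makes all remaining potentials bounded
(`exists_isPartialOrientation_of_colorable`). Then each level fixes a maximum independent set of the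
vertices of potential at least `t` (`exists_descent`). By Hall's theorem every other such vertex
loses an out-arc; favouring early vertices in the choice makes potential plus number of unfixed
earlier neighbours drop by two. The level drops by one, so it would catch up with any surviving
vertex. -/

namespace SimpleGraph

/-! ### Degeneracy and colouring -/

/-- Every nonempty vertex set contains a vertex with at most `maxAverageDegree` neighbours in it. -/
theorem exists_card_adj_le_maxAverageDegree {V : Type*} [Fintype V] [DecidableEq V]
    (G : SimpleGraph V) [DecidableRel G.Adj] (S : Finset V) (hS : S.Nonempty) :
    ∃ v ∈ S, ((S.filter fun w => G.Adj v w).card : ℝ) ≤ G.maxAverageDegree := by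
  classical
  by_contra! hcon
  obtain ⟨s, hs⟩ := hS
  have : Nonempty V := ⟨s⟩
  let H : G.Subgraph := (⊤ : G.Subgraph).induce (S : Set V)
  have hH : 2 * (H.edgeSet.ncard : ℝ) / (H.verts.ncard : ℝ) ≤ G.maxAverageDegree :=
    (isGreatest_maxAverageDegree G).2 ⟨H, ⟨s, hs⟩, rfl⟩
  have hverts : H.verts.ncard = S.card := Set.ncard_coe_finset S
  have hpos : (0 : ℝ) < S.card := by exact_mod_cast Finset.card_pos.2 ⟨s, hs⟩
  rw [hverts, div_le_iff₀ hpos] at hH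
  have hdeg : ∀ v ∈ S, H.spanningCoe.degree v = (S.filter fun w => G.Adj v w).card := by
    intro v hv
    rw [← card_neighborFinset_eq_degree]
    congr 1
    ext w
    simp [H, hv]
  have hsum : (∑ v ∈ S, ((S.filter fun w => G.Adj v w).card : ℝ)) ≤
      2 * (H.edgeSet.ncard : ℝ) := by
    have h1 := H.spanningCoe.sum_degrees_eq_twice_card_edges
    have h2 : H.spanningCoe.edgeFinset.card = H.edgeSet.ncard := by
      rw [← Set.ncard_coe_finset, coe_edgeFinset, Subgraph.edgeSet_spanningCoe]
    have h3 : ∑ v ∈ S, (S.filter fun w => G.Adj v w).card ≤ 2 * H.edgeSet.ncard := by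
      rw [← h2, ← h1, ← Finset.sum_congr rfl hdeg]
      exact Finset.sum_le_sum_of_subset (Finset.subset_univ S)
    exact_mod_cast h3
  have hlt := Finset.sum_lt_sum_of_nonempty ⟨s, hs⟩ hcon
  rw [Finset.sum_const, nsmul_eq_mul] at hlt
  linarith

/-- If every nonempty vertex set contains a vertex with at most `δ` neighbours in it, the vertices
can be ordered so that each has at most `δ` earlier neighbours. -/
theorem exists_degenerate_order {V : Type*} [Fintype V] [DecidableEq V]
    (G : SimpleGraph V) [DecidableRel G.Adj] (δ : ℕ)
    (h : ∀ S : Finset V, S.Nonempty → ∃ v ∈ S, (S.filter fun w => G.Adj v w).card ≤ δ) :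
    ∃ π : V → ℕ, Function.Injective π ∧
      ∀ v, (Finset.univ.filter fun w => G.Adj v w ∧ π w < π v).card ≤ δ := by
  suffices H : ∀ n : ℕ, ∀ S : Finset V, S.card = n → ∃ π : V → ℕ, Set.InjOn π S ∧
      ∀ v ∈ S, (S.filter fun w => G.Adj v w ∧ π w < π v).card ≤ δ by
    obtain ⟨π, hinj, hπ⟩ := H _ Finset.univ rfl
    exact ⟨π, by simpa using hinj, fun v => hπ v (Finset.mem_univ v)⟩
  intro n
  induction n with
  | zero =>
    intro S hS
    rw [Finset.card_eq_zero.1 hS]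
    exact ⟨fun _ => 0, by simp, by simp⟩
  | succ n ih =>
    intro S hS
    obtain ⟨v, hv, hdeg⟩ := h S (Finset.card_pos.1 (by omega))
    obtain ⟨π, hinj, hπ⟩ := ih (S.erase v) (by rw [Finset.card_erase_of_mem hv]; omega)
    have hlt : ∀ w ∈ S, π w < S.sup π + 1 := fun w hw => Nat.lt_succ_of_le (Finset.le_sup hw)
    -- The vertex of small degree goes last, so it is never an earlier neighbour of the others.
    refine ⟨Function.update π v (S.sup π + 1), ?_, ?_⟩
    · intro a ha b hb hab
      by_cases hav : a = v <;> by_cases hbv : b = v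
      · rw [hav, hbv]
      · subst hav
        have := hlt b hb
        simp [hbv] at hab
        omega
      · subst hbv
        have := hlt a ha
        simp [hav] at hab
        omega
      · simp only [Function.update_of_ne hav, Function.update_of_ne hbv] at hab
        exact hinj (by simp [hav]; exact ha) (by simp [hbv]; exact hb) hab
    · intro a ha
      by_cases hav : a = v
      · subst hav
        exact (Finset.card_le_card (Finset.monotone_filter_right _ fun w _ hw => hw.1)).trans hdeg
      · refine (Finset.card_le_card ?_).trans (hπ a (Finset.mem_erase.2 ⟨hav, ha⟩))
        intro w hw
        rw [Finset.mem_filter] at hw ⊢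
        obtain ⟨hwS, hadj, hw⟩ := hw
        have hwv : w ≠ v := by
          rintro rfl
          have := hlt a ha
          simp [hav] at hw
          omega
        simp only [Function.update_of_ne hav, Function.update_of_ne hwv] at hw
        exact ⟨Finset.mem_erase.2 ⟨hwv, hwS⟩, hadj, hw⟩

/-- Greedy colouring along an order in which each vertex has at most `δ` earlier neighbours. -/
theorem colorable_of_degenerate_order {V : Type*} [Fintype V] [DecidableEq V]
    (G : SimpleGraph V) [DecidableRel G.Adj] (δ : ℕ) (π : V → ℕ) (hinj : Function.Injective π)
    (hπ : ∀ v, (Finset.univ.filter fun w => G.Adj v w ∧ π w < π v).card ≤ δ) :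
    G.Colorable (δ + 1) := by
  suffices H : ∀ n : ℕ, ∃ c : V → Fin (δ + 1), ∀ u v, π u < n → π v < n → G.Adj u v →
      c u ≠ c v by
    obtain ⟨c, hc⟩ := H (Finset.univ.sup π + 1)
    have hlt : ∀ w, π w < Finset.univ.sup π + 1 :=
      fun w => Nat.lt_succ_of_le (Finset.le_sup (Finset.mem_univ w))
    exact ⟨Coloring.mk c fun {u v} huv => hc u v (hlt u) (hlt v) huv⟩
  intro n
  induction n with
  | zero => exact ⟨fun _ => 0, by simp⟩
  | succ n ih =>
    obtain ⟨c, hc⟩ := ih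
    by_cases hn : ∃ v, π v = n
    · obtain ⟨v, rfl⟩ := hn
      have hex : ∃ i : Fin (δ + 1),
          i ∉ (Finset.univ.filter fun w => G.Adj v w ∧ π w < π v).image c := by
        by_contra! hall
        have := Finset.card_le_card (fun i _ => hall i : (Finset.univ : Finset (Fin (δ + 1))) ⊆ _)
        have := Finset.card_image_le (f := c)
          (s := Finset.univ.filter fun w => G.Adj v w ∧ π w < π v)
        have := hπ v
        simp at *
        omega
      obtain ⟨i, hi⟩ := hex
      have hi' : ∀ w, G.Adj v w → π w < π v → c w ≠ i := by
        intro w h1 h2 h3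
        exact hi (Finset.mem_image.2 ⟨w, by simp [h1, h2], h3⟩)
      refine ⟨Function.update c v i, fun a b ha hb hab => ?_⟩
      by_cases hav : a = v <;> by_cases hbv : b = v
      · subst hav; subst hbv; exact (hab.ne rfl).elim
      · subst hav
        have : π b ≠ π a := fun h => hbv (hinj h)
        simpa [hbv] using (hi' b hab (by omega)).symm
      · subst hbv
        have : π a ≠ π b := fun h => hav (hinj h)
        simpa [hav] using hi' a hab.symm (by omega)
      · have h1 : π a ≠ π v := fun h => hav (hinj h)
        have h2 : π b ≠ π v := fun h => hbv (hinj h)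
        simpa [hav, hbv] using hc a b (by omega) (by omega) hab
    · push Not at hn
      refine ⟨c, fun a b ha hb => hc a b ?_ ?_⟩
      · have := hn a; omega
      · have := hn b; omega

/-! ### Maximum independent sets and Hall's theorem -/

/-- A largest independent subset of `P`, with ties broken towards early vertices. The vertices of
`P` outside of it can be distributed among their neighbours in it with at most `r` for each. -/
theorem exists_independent_assignment {V : Type*} [Fintype V] [DecidableEq V]
    (G : SimpleGraph V) {r : ℕ} (hG : G.Colorable r) (π : V → ℕ) (P : Finset V) :
    ∃ I ⊆ P, (∀ u ∈ I, ∀ v ∈ I, ¬ G.Adj u v) ∧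
      (∀ z ∈ P, z ∉ I → (∃ w ∈ I, G.Adj z w ∧ π w ≤ π z) ∨
        ∃ w₁ ∈ I, ∃ w₂ ∈ I, w₁ ≠ w₂ ∧ G.Adj z w₁ ∧ G.Adj z w₂) ∧
      ∃ b : V → V, (∀ z ∈ P, z ∉ I → b z ∈ I ∧ G.Adj z (b z)) ∧
        ∀ u, ((P \ I).filter fun z => b z = u).card ≤ r := by
  classical
  -- `K` exceeds every sum of values of `π` over a set, so maximizing `f` maximizes the cardinality
  -- first and then minimizes the sum of `π`.
  let K : ℤ := ∑ v : V, (π v : ℤ) + 1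
  let f : Finset V → ℤ := fun J => ∑ v ∈ J, (K - π v)
  have hf : ∀ J, f J = J.card * K - ∑ v ∈ J, (π v : ℤ) := by
    intro J
    simp only [f, Finset.sum_sub_distrib, Finset.sum_const, nsmul_eq_mul]
  let F : Finset (Finset V) := P.powerset.filter fun J => ∀ u ∈ J, ∀ v ∈ J, ¬ G.Adj u v
  obtain ⟨I, hIF, hmax⟩ := F.exists_max_image f ⟨∅, by simp [F]⟩
  obtain ⟨hIP, hind⟩ : I ⊆ P ∧ ∀ u ∈ I, ∀ v ∈ I, ¬ G.Adj u v := by simpa [F] using hIF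
  have hmax' : ∀ J ⊆ P, (∀ u ∈ J, ∀ v ∈ J, ¬ G.Adj u v) → f J ≤ f I :=
    fun J h1 h2 => hmax J (by simp only [F, Finset.mem_filter, Finset.mem_powerset]; exact ⟨h1, h2⟩)
  have hcard : ∀ J ⊆ P, (∀ u ∈ J, ∀ v ∈ J, ¬ G.Adj u v) → J.card ≤ I.card := by
    intro J h1 h2
    by_contra! hlt
    have h3 := hmax' J h1 h2
    rw [hf, hf] at h3
    have h4 : ∑ v ∈ J, (π v : ℤ) ≤ ∑ v : V, (π v : ℤ) :=
      Finset.sum_le_sum_of_subset_of_nonneg (Finset.subset_univ J) fun _ _ _ => by positivity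
    have h5 : 0 ≤ ∑ v ∈ I, (π v : ℤ) := Finset.sum_nonneg fun _ _ => by positivity
    have h6 : ((I.card : ℤ) + 1) * K ≤ J.card * K := by
      apply mul_le_mul_of_nonneg_right (by exact_mod_cast hlt)
      have : 0 ≤ ∑ v : V, (π v : ℤ) := Finset.sum_nonneg fun _ _ => by positivity
      simp only [K]; omega
    have h7 : K = ∑ v : V, (π v : ℤ) + 1 := rfl
    linarith
  refine ⟨I, hIP, hind, ?_, ?_⟩
  · intro z hz hzI
    by_contra! hcon
    obtain ⟨h1, h2⟩ := hcon
    by_cases hw : ∃ w ∈ I, G.Adj z w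
    · obtain ⟨w, hwI, hzw⟩ := hw
      have hzE : z ∉ I.erase w := fun h => hzI (Finset.mem_of_mem_erase h)
      have h3 : ∀ v ∈ I.erase w, ¬ G.Adj z v := fun v hv hzv =>
        h2 w hwI v (Finset.mem_of_mem_erase hv) (Finset.ne_of_mem_erase hv).symm hzw hzv
      -- If `w` is the only neighbour of `z` in `I`, exchanging `w` for `z` cannot increase `f`,
      -- which forces `π w ≤ π z`.
      have h4 := hmax' (insert z (I.erase w)) ?_ ?_
      · have h5 := Finset.add_sum_erase I (fun v => K - (π v : ℤ)) hwI
        simp only [f, Finset.sum_insert hzE] at h4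
        have h6 := h1 w hwI hzw
        omega
      · exact Finset.insert_subset hz ((Finset.erase_subset _ _).trans hIP)
      · intro u hu v hv huv
        rcases Finset.mem_insert.1 hu with rfl | hu' <;>
          rcases Finset.mem_insert.1 hv with rfl | hv'
        · exact huv.ne rfl
        · exact h3 v hv' huv
        · exact h3 u hu' huv.symm
        · exact hind u (Finset.mem_of_mem_erase hu') v (Finset.mem_of_mem_erase hv') huv
    · push Not at hw
      have h4 := hcard (insert z I) (Finset.insert_subset hz hIP) ?_
      · rw [Finset.card_insert_of_notMem hzI] at h4
        omega
      · intro u hu v hv huv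
        rcases Finset.mem_insert.1 hu with rfl | hu' <;>
          rcases Finset.mem_insert.1 hv with rfl | hv'
        · exact huv.ne rfl
        · exact hw v hv' huv
        · exact hw u hu' huv.symm
        · exact hind u hu' v hv' huv
  · obtain ⟨c⟩ := hG
    -- Each vertex of `I` is offered in `r` copies, so an injective choice uses it at most `r`
    -- times.
    let t : {z // z ∈ P \ I} → Finset (V × Fin r) := fun z =>
      (I.filter fun w => G.Adj z w) ×ˢ Finset.univ
    have hall : ∀ s : Finset {z // z ∈ P \ I}, s.card ≤ (s.biUnion t).card := by
      intro s
      let S : Finset V := s.map (Function.Embedding.subtype _)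
      let A : Finset V := I.filter fun w => ∃ z ∈ S, G.Adj z w
      have hS : ∀ z ∈ S, z ∈ P ∧ z ∉ I := by
        intro z hz
        obtain ⟨y, -, rfl⟩ := Finset.mem_map.1 hz
        exact Finset.mem_sdiff.1 y.2
      have h1 : A ×ˢ (Finset.univ : Finset (Fin r)) ⊆ s.biUnion t := by
        rintro ⟨w, i⟩ hw
        obtain ⟨hwI, z, hz, hzw⟩ := Finset.mem_filter.1 (Finset.mem_product.1 hw).1
        obtain ⟨y, hy, rfl⟩ := Finset.mem_map.1 hz
        refine Finset.mem_biUnion.2 ⟨y, hy, ?_⟩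
        simp only [t, Finset.mem_product, Finset.mem_filter, Finset.mem_univ, and_true]
        exact ⟨hwI, hzw⟩
      have h2 : S.card ≤ A.card * (Finset.univ : Finset (Fin r)).card := by
        refine Finset.card_le_mul_card_image_of_maps_to (f := c) (fun _ _ => Finset.mem_univ _) _ ?_
        intro i _
        -- Replacing `A`, the neighbours of `S` in `I`, by one colour class of `S` keeps
        -- independence, so each of the `r` classes has at most `A.card` vertices.
        have h3 := hcard ((I \ A) ∪ S.filter fun a => c a = i) ?_ ?_
        · rw [Finset.card_union_of_disjoint, Finset.card_sdiff_of_subset (Finset.filter_subset _ _)]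
            at h3
          · have := Finset.card_le_card (Finset.filter_subset (fun w => ∃ z ∈ S, G.Adj z w) I)
            change A.card ≤ I.card at this
            change I.card - A.card + _ ≤ _ at h3
            omega
          · rw [Finset.disjoint_left]
            intro a ha ha'
            exact (hS a (Finset.mem_filter.1 ha').1).2 (Finset.mem_sdiff.1 ha).1
        · apply Finset.union_subset (Finset.sdiff_subset.trans hIP)
          intro a ha
          exact (hS a (Finset.mem_filter.1 ha).1).1
        · have hcross : ∀ u ∈ I \ A, ∀ v ∈ S.filter (fun a => c a = i), ¬ G.Adj u v := by
            intro u hu v hv huv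
            obtain ⟨hu1, hu2⟩ := Finset.mem_sdiff.1 hu
            exact hu2 (Finset.mem_filter.2 ⟨hu1, v, (Finset.mem_filter.1 hv).1, huv.symm⟩)
          intro u hu v hv huv
          rcases Finset.mem_union.1 hu with hu | hu <;> rcases Finset.mem_union.1 hv with hv | hv
          · exact hind u (Finset.mem_sdiff.1 hu).1 v (Finset.mem_sdiff.1 hv).1 huv
          · exact hcross u hu v hv huv
          · exact hcross v hv u hu huv.symm
          · exact c.valid huv ((Finset.mem_filter.1 hu).2.trans (Finset.mem_filter.1 hv).2.symm)
      have h3 := Finset.card_le_card h1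
      rw [Finset.card_product] at h3
      rw [Finset.card_map] at h2
      omega
    obtain ⟨g, hginj, hg⟩ := (Finset.all_card_le_biUnion_card_iff_existsInjective' t).1 hall
    let b : V → V := fun z => if hz : z ∈ P \ I then (g ⟨z, hz⟩).1 else z
    refine ⟨b, ?_, ?_⟩
    · intro z hz hzI
      have hz' : z ∈ P \ I := Finset.mem_sdiff.2 ⟨hz, hzI⟩
      have := (Finset.mem_product.1 (hg ⟨z, hz'⟩)).1
      simp only [b, hz', dif_pos]
      exact Finset.mem_filter.1 this
    · intro u
      let S := (P \ I).filter fun z => b z = u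
      have hS : ∀ z : {z // z ∈ S}, z.1 ∈ P \ I := fun z => (Finset.mem_filter.1 z.2).1
      have hinj : Function.Injective fun z : {z // z ∈ S} => (g ⟨z.1, hS z⟩).2 := by
        intro x y hxy
        have hx : (g ⟨x.1, hS x⟩).1 = u := by
          have := (Finset.mem_filter.1 x.2).2
          simpa only [b, hS x, dif_pos] using this
        have hy : (g ⟨y.1, hS y⟩).1 = u := by
          have := (Finset.mem_filter.1 y.2).2
          simpa only [b, hS y, dif_pos] using this
        have := hginj (Prod.ext (hx.trans hy.symm) hxy)
        exact Subtype.ext (congrArg (fun a : {z // z ∈ P \ I} => a.1) this)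
      simpa using Fintype.card_le_of_injective _ hinj

/-! ### Partial orientations -/

/-- The vertices to which `u` may still point when the admissible arcs are given by `B`. -/
noncomputable def outSet {V : Type*} [Fintype V] (B : V → V → Prop) (u : V) : Finset V := by
  classical exact Finset.univ.filter (B u)

theorem mem_outSet {V : Type*} [Fintype V] {B : V → V → Prop} {u v : V} :
    v ∈ outSet B u ↔ B u v := by
  simp [outSet]

/-- A partially chosen orientation: `B` is the relation of the arcs still admissible, an edge being
undecided as long as both of its arcs are. All edges at vertices outside of `X` are decided, these
vertices have properly chosen outdegrees in `[t, N]`, and an arc that a vertex of `X` is forced to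
send out goes to an earlier vertex in the order `π`. -/
structure IsPartialOrientation {V : Type*} [Fintype V] (G : SimpleGraph V) (π : V → ℕ)
    (N t : ℕ) (X : Finset V) (B : V → V → Prop) : Prop where
  adj : ∀ u v, B u v → G.Adj u v
  total : ∀ u v, G.Adj u v → B u v ∨ B v u
  free : ∀ u ∈ X, ∀ v ∈ X, G.Adj u v → B u v
  decided : ∀ u, u ∉ X → ∀ v, B u v → ¬ B v u
  forced : ∀ u ∈ X, ∀ v, B u v → ¬ B v u → π v < π u
  low : ∀ u, u ∉ X → t ≤ (outSet B u).card
  high : ∀ u, u ∉ X → (outSet B u).card ≤ N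
  proper : ∀ u, u ∉ X → ∀ v, v ∉ X → G.Adj u v → (outSet B u).card ≠ (outSet B v).card

/-- The admissible arcs after the edges at the vertices `u ∈ I` have been decided: the undecided
edges between `u` and `R u` are directed to `u`, the other ones away from `u`. -/
def decideArcs {V : Type*} (B : V → V → Prop) (I : Finset V) (R : V → Finset V) (a b : V) : Prop :=
  B a b ∧ (a ∈ I → b ∉ R a) ∧ (b ∈ I → B b a → a ∈ R b)

variable {V : Type*} [Fintype V] {G : SimpleGraph V} {π : V → ℕ} {N t : ℕ}
  {X : Finset V} {B : V → V → Prop}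

theorem IsPartialOrientation.outSet_decideArcs_of_mem [DecidableEq V]
    (h : IsPartialOrientation G π N (t + 1) X B)
    {I : Finset V} (hind : ∀ u ∈ I, ∀ v ∈ I, ¬ G.Adj u v) (R : V → Finset V) {u : V} (hu : u ∈ I) :
    outSet (decideArcs B I R) u = outSet B u \ R u := by
  ext v
  simp only [mem_outSet, Finset.mem_sdiff, decideArcs]
  constructor
  · exact fun hv => ⟨hv.1, hv.2.1 hu⟩
  · exact fun hv => ⟨hv.1, fun _ => hv.2, fun hvI _ => (hind u hu v hvI (h.adj u v hv.1)).elim⟩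

theorem IsPartialOrientation.outSet_decideArcs_of_notMem
    (h : IsPartialOrientation G π N (t + 1) X B) {I : Finset V} (hIX : I ⊆ X)
    (R : V → Finset V) {u : V} (hu : u ∉ X) :
    outSet (decideArcs B I R) u = outSet B u := by
  ext v
  simp only [mem_outSet, decideArcs]
  exact ⟨fun hv => hv.1, fun hv => ⟨hv, fun huI => (hu (hIX huI)).elim,
    fun _ hvu => (h.decided u hu v hv hvu).elim⟩⟩

/-- The outdegrees of the vertices of an independent set `I` can be fixed to be `t`, if the surplus
arcs can be turned around along undecided edges to later vertices. -/
theorem IsPartialOrientation.decideArcs [DecidableEq V]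
    (h : IsPartialOrientation G π N (t + 1) X B)
    {I : Finset V} (hIX : I ⊆ X) (hind : ∀ u ∈ I, ∀ v ∈ I, ¬ G.Adj u v) {R : V → Finset V}
    (hR : ∀ u ∈ I, ∀ v ∈ R u, B u v ∧ π u < π v)
    (hcard : ∀ u ∈ I, (R u).card + t = (outSet B u).card) (htN : t ≤ N) :
    IsPartialOrientation G π N t (X \ I) (SimpleGraph.decideArcs B I R) := by
  have hI : ∀ u ∈ I, (outSet (SimpleGraph.decideArcs B I R) u).card = t := by
    intro u hu
    rw [h.outSet_decideArcs_of_mem hind R hu, Finset.card_sdiff_of_subset, ← hcard u hu]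
    · omega
    · exact fun v hv => mem_outSet.2 (hR u hu v hv).1
  have hX : ∀ u, u ∉ X → (outSet (SimpleGraph.decideArcs B I R) u).card = (outSet B u).card :=
    fun u hu => by rw [h.outSet_decideArcs_of_notMem hIX R hu]
  have hcases : ∀ u, u ∉ X \ I → u ∈ I ∨ u ∉ X := by
    intro u hu
    by_contra! hcon
    exact hu (Finset.mem_sdiff.2 ⟨hcon.2, hcon.1⟩)
  refine ⟨fun u v huv => h.adj u v huv.1, ?_, ?_, ?_, ?_, ?_, ?_, ?_⟩
  · have key : ∀ u v, G.Adj u v → u ∈ I →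
        SimpleGraph.decideArcs B I R u v ∨ SimpleGraph.decideArcs B I R v u := by
      intro u v huv hu
      have hv : v ∉ I := fun hv => hind u hu v hv huv
      by_cases hvR : v ∈ R u
      · have hvu : B v u := by
          by_contra hvu
          have := h.forced u (hIX hu) v (hR u hu v hvR).1 hvu
          have := (hR u hu v hvR).2
          omega
        exact Or.inr ⟨hvu, fun h => (hv h).elim, fun _ _ => hvR⟩
      · by_cases hB : B u v
        · exact Or.inl ⟨hB, fun _ => hvR, fun h => (hv h).elim⟩
        · exact Or.inr ⟨(h.total u v huv).resolve_left hB, fun h => (hv h).elim,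
            fun _ h => (hB h).elim⟩
    intro u v huv
    by_cases hu : u ∈ I
    · exact key u v huv hu
    by_cases hv : v ∈ I
    · exact (key v u huv.symm hv).symm
    exact (h.total u v huv).imp (fun hB => ⟨hB, fun h => (hu h).elim, fun h => (hv h).elim⟩)
      fun hB => ⟨hB, fun h => (hv h).elim, fun h => (hu h).elim⟩
  · intro u hu v hv huv
    obtain ⟨hu1, hu2⟩ := Finset.mem_sdiff.1 hu
    obtain ⟨hv1, hv2⟩ := Finset.mem_sdiff.1 hv
    exact ⟨h.free u hu1 v hv1 huv, fun h => (hu2 h).elim, fun h => (hv2 h).elim⟩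
  · intro u hu v huv hvu
    rcases hcases u hu with hu | hu
    · exact huv.2.1 hu (hvu.2.2 hu huv.1)
    · exact h.decided u hu v huv.1 hvu.1
  · intro u hu v huv hvu
    obtain ⟨hu1, hu2⟩ := Finset.mem_sdiff.1 hu
    by_cases hvu' : B v u
    · have h1 : v ∈ I ∧ u ∈ R v := by
        by_contra hcon
        have h2 := huv.2.2
        exact hvu ⟨hvu', fun hv hu' => hcon ⟨hv, hu'⟩, fun h => (hu2 h).elim⟩
      exact (hR v h1.1 u h1.2).2
    · exact h.forced u hu1 v huv.1 hvu'
  · intro u hu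
    rcases hcases u hu with hu | hu
    · rw [hI u hu]
    · rw [hX u hu]; have := h.low u hu; omega
  · intro u hu
    rcases hcases u hu with hu | hu
    · rwa [hI u hu]
    · rw [hX u hu]; exact h.high u hu
  · intro u hu v hv huv
    rcases hcases u hu with hu | hu <;> rcases hcases v hv with hv | hv
    · exact (hind u hu v hv huv).elim
    · rw [hI u hu, hX v hv]; have := h.low v hv; omega
    · rw [hI v hv, hX u hu]; have := h.low u hu; omega
    · rw [hX u hu, hX v hv]; exact h.proper u hu v hv huv

/-! ### The two descents -/

variable {δ r : ℕ}

/-- Enough undecided edges to later vertices remain to turn the surplus arcs of a vertex around,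
even if the vertices of a small set `S` are to be avoided. -/
theorem IsPartialOrientation.exists_surplus [DecidableEq V] [DecidableRel G.Adj]
    (h : IsPartialOrientation G π N (t + 1) X B) (hinj : Function.Injective π)
    (hπ : ∀ v, (Finset.univ.filter fun w => G.Adj v w ∧ π w < π v).card ≤ δ) {u : V}
    (S : Finset V) (ht : t ≤ (outSet B u).card)
    (hS : t < (outSet B u).card → δ + S.card ≤ t) :
    ∃ R : Finset V, (∀ v ∈ R, B u v ∧ π u < π v ∧ v ∉ S) ∧ R.card + t = (outSet B u).card := by
  rcases ht.eq_or_lt with ht | ht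
  · exact ⟨∅, by simp, by simp [ht]⟩
  -- At most `δ` admissible arcs lead to earlier vertices, so `A \ S` has at least `(outSet B
  -- u).card - δ - S.card` elements, enough for the surplus.
  let A := (outSet B u).filter fun v => π u < π v
  have h1 : outSet B u ⊆ A ∪ Finset.univ.filter fun w => G.Adj u w ∧ π w < π u := by
    intro v hv
    have hadj := h.adj u v (mem_outSet.1 hv)
    have hne : π u ≠ π v := fun he => hadj.ne (hinj he)
    simp only [A, Finset.mem_union, Finset.mem_filter, Finset.mem_univ, true_and, hv, hadj]
    omega
  have h2 := (Finset.card_le_card h1).trans (Finset.card_union_le _ _)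
  have h3 := hπ u
  have h4 := Finset.le_card_sdiff S A
  have h5 := hS ht
  obtain ⟨R, hRA, hR⟩ := Finset.exists_subset_card_eq
    (show (outSet B u).card - t ≤ (A \ S).card by omega)
  refine ⟨R, fun v hv => ?_, by omega⟩
  obtain ⟨h6, h7⟩ := Finset.mem_sdiff.1 (hRA hv)
  obtain ⟨h8, h9⟩ := Finset.mem_filter.1 h6
  exact ⟨mem_outSet.1 h8, h9, h7⟩

theorem outSet_decideArcs_subset (B : V → V → Prop) (I : Finset V) (R : V → Finset V) (u : V) :
    outSet (decideArcs B I R) u ⊆ outSet B u :=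
  fun _ hv => mem_outSet.2 (mem_outSet.1 hv).1

/-- Fixing the outdegrees of the vertices of large potential outdegree, one colour class after the
other. -/
theorem exists_isPartialOrientation_of_colorable (hinj : Function.Injective π) (hG : G.Colorable r)
    [DecidableRel G.Adj]
    (hπ : ∀ v, (Finset.univ.filter fun w => G.Adj v w ∧ π w < π v).card ≤ δ) {T : ℕ} (hT : δ ≤ T) :
    ∃ X B, IsPartialOrientation G π (T + r) T X B ∧ ∀ z ∈ X, (outSet B z).card < T + r := by
  classical
  obtain ⟨c⟩ := hG
  suffices H : ∀ j ≤ r, ∃ X B, IsPartialOrientation G π (T + r) (T + (r - j)) X B ∧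
      ∀ z ∈ X, (c z).val < j → (outSet B z).card < T + r by
    obtain ⟨X, B, h1, h2⟩ := H r le_rfl
    rw [Nat.sub_self, add_zero] at h1
    exact ⟨X, B, h1, fun z hz => h2 z hz (c z).isLt⟩
  intro j
  induction j with
  | zero =>
    intro _
    refine ⟨Finset.univ, G.Adj, ⟨fun _ _ h => h, fun _ _ h => Or.inl h, fun _ _ _ _ h => h, ?_, ?_,
      ?_, ?_, ?_⟩, by simp⟩
    · simp
    · exact fun u _ v huv hvu => (hvu huv.symm).elim
    · simp
    · simp
    · simp
  | succ j ih =>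
    intro hj
    obtain ⟨X, B, h, hX⟩ := ih (by omega)
    obtain ⟨t, ht⟩ : ∃ t, t = T + (r - (j + 1)) := ⟨_, rfl⟩
    rw [show T + (r - j) = t + 1 by omega] at h
    rw [← ht]
    let I := X.filter fun z => (c z).val = j ∧ t ≤ (outSet B z).card
    have hmem : ∀ u ∈ I, u ∈ X ∧ (c u).val = j ∧ t ≤ (outSet B u).card :=
      fun u hu => Finset.mem_filter.1 hu
    have hpush : ∀ u, ∃ R : Finset V, u ∈ I → (∀ v ∈ R, B u v ∧ π u < π v) ∧
        R.card + t = (outSet B u).card := by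
      intro u
      by_cases hu : u ∈ I
      · obtain ⟨R, hR, hcard⟩ := h.exists_surplus hinj hπ (u := u) ∅ (hmem u hu).2.2
          (fun _ => by rw [Finset.card_empty]; omega)
        exact ⟨R, fun _ => ⟨fun v hv => ⟨(hR v hv).1, (hR v hv).2.1⟩, hcard⟩⟩
      · exact ⟨∅, fun h => (hu h).elim⟩
    choose R hR using hpush
    refine ⟨X \ I, SimpleGraph.decideArcs B I R, h.decideArcs (Finset.filter_subset _ _) ?_
      (fun u hu => (hR u hu).1) (fun u hu => (hR u hu).2) (by omega), ?_⟩
    · intro u hu v hv huv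
      exact c.valid huv (Fin.ext ((hmem u hu).2.1.trans (hmem v hv).2.1.symm))
    · intro z hz hcz
      obtain ⟨hzX, hzI⟩ := Finset.mem_sdiff.1 hz
      refine (Finset.card_le_card (outSet_decideArcs_subset B I R z)).trans_lt ?_
      rcases Nat.lt_succ_iff_lt_or_eq.1 hcz with hcz | hcz
      · exact hX z hzX hcz
      · by_contra! hle
        exact hzI (Finset.mem_filter.2 ⟨hzX, hcz, by omega⟩)

/-- One step of the descent: a largest independent set of the vertices of potential outdegree at
least `t` gets the outdegree `t`, and the other ones of these vertices lose potential outdegree. -/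
theorem IsPartialOrientation.exists_descent [DecidableRel G.Adj]
    (h : IsPartialOrientation G π N (t + 1) X B) (hinj : Function.Injective π) (hG : G.Colorable r)
    (hπ : ∀ v, (Finset.univ.filter fun w => G.Adj v w ∧ π w < π v).card ≤ δ) (htN : t ≤ N)
    (hX : ∀ z ∈ X, (outSet B z).card < t + 1 ∨
      (outSet B z).card + (X.filter fun w => G.Adj z w ∧ π w < π z).card + (δ + r + 1) ≤
        2 * (t + 1)) :
    ∃ X' B', IsPartialOrientation G π N t X' B' ∧ ∀ z ∈ X', (outSet B' z).card < t ∨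
      (outSet B' z).card + (X'.filter fun w => G.Adj z w ∧ π w < π z).card + (δ + r + 1) ≤
        2 * t := by
  classical
  let P := X.filter fun z => t ≤ (outSet B z).card
  have hPX : P ⊆ X := Finset.filter_subset _ _
  obtain ⟨I, hIP, hind, hnbr, b, hb, hbr⟩ := exists_independent_assignment G hG π P
  have hIX := hIP.trans hPX
  have hpush : ∀ u, ∃ R : Finset V, u ∈ I → (∀ v ∈ R, B u v ∧ π u < π v ∧
      v ∉ (P \ I).filter fun z => b z = u) ∧ R.card + t = (outSet B u).card := by
    intro u
    by_cases hu : u ∈ I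
    -- The vertices assigned to `u` by `b` are kept out of `R u`, so `u` will point to them. A
    -- surplus means potential at least `t + 1`, and then the second alternative of `hX` gives `δ +
    -- r ≤ t`; this is why it contains `δ + r + 1`.
    · obtain ⟨R, hR⟩ := h.exists_surplus hinj hπ (u := u) ((P \ I).filter fun z => b z = u)
        (Finset.mem_filter.1 (hIP hu)).2 (fun hlt => by
          have := hX u (hIX hu)
          have := hbr u
          omega)
      exact ⟨R, fun _ => hR⟩
    · exact ⟨∅, fun h => (hu h).elim⟩
  choose R hR using hpush
  refine ⟨X \ I, SimpleGraph.decideArcs B I R, h.decideArcs hIX hind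
    (fun u hu v hv => ⟨((hR u hu).1 v hv).1, ((hR u hu).1 v hv).2.1⟩)
    (fun u hu => (hR u hu).2) htN, ?_⟩
  intro z hz
  obtain ⟨hzX, hzI⟩ := Finset.mem_sdiff.1 hz
  have hle := Finset.card_le_card (outSet_decideArcs_subset B I R z)
  by_cases hzP : z ∈ P
  swap
  · left
    by_contra! hcon
    exact hzP (Finset.mem_filter.2 ⟨hzX, by omega⟩)
  have hdrop : ∀ u ∈ I, G.Adj z u → z ∉ R u →
      u ∈ outSet B z ∧ u ∉ outSet (SimpleGraph.decideArcs B I R) z := by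
    intro u hu hzu hzR
    refine ⟨mem_outSet.2 (h.free z hzX u (hIX hu) hzu), fun hmem => hzR ?_⟩
    exact (mem_outSet.1 hmem).2.2 hu (h.free u (hIX hu) z hzX hzu.symm)
  obtain ⟨hbI, hbz⟩ := hb z hzP hzI
  have hone : (outSet (SimpleGraph.decideArcs B I R) z).card < (outSet B z).card := by
    obtain ⟨h1, h2⟩ := hdrop (b z) hbI hbz fun hzR => ((hR _ hbI).1 z hzR).2.2
      (Finset.mem_filter.2 ⟨Finset.mem_sdiff.2 ⟨hzP, hzI⟩, rfl⟩)
    exact Finset.card_lt_card ⟨outSet_decideArcs_subset B I R z, fun hs => h2 (hs h1)⟩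
  rcases hX z hzX with hlt | hX
  · left; omega
  right
  have hsub : ((X \ I).filter fun w => G.Adj z w ∧ π w < π z) ⊆
      X.filter fun w => G.Adj z w ∧ π w < π z :=
    Finset.filter_subset_filter _ Finset.sdiff_subset
  -- An earlier neighbour in `I` leaves the count of earlier neighbours, in addition to the arc lost
  -- to `b z`. Otherwise two later neighbours lie in `I`; neither reverses an arc towards the
  -- earlier `z`, so `z` loses two arcs.
  by_cases hearly : ∃ w ∈ I, G.Adj z w ∧ π w ≤ π z
  · obtain ⟨w, hwI, hzw, hw⟩ := hearly
    have hw' : π w < π z := lt_of_le_of_ne hw fun he => hzw.ne (hinj he).symm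
    have h3 : ((X \ I).filter fun w => G.Adj z w ∧ π w < π z).card <
        (X.filter fun w => G.Adj z w ∧ π w < π z).card :=
      Finset.card_lt_card ⟨hsub, fun hs =>
        (Finset.mem_sdiff.1 (Finset.mem_filter.1
          (hs (Finset.mem_filter.2 ⟨hIX hwI, hzw, hw'⟩))).1).2 hwI⟩
    omega
  · have h3 := Finset.card_le_card hsub
    obtain ⟨w₁, hw₁, w₂, hw₂, hne, hz₁, hz₂⟩ := (hnbr z hzP hzI).resolve_left hearly
    have hlate : ∀ w ∈ I, G.Adj z w → z ∉ R w := by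
      intro w hw hzw hzR
      exact hearly ⟨w, hw, hzw, ((hR w hw).1 z hzR).2.1.le⟩
    obtain ⟨h4, h5⟩ := hdrop w₁ hw₁ hz₁ (hlate w₁ hw₁ hz₁)
    obtain ⟨h6, h7⟩ := hdrop w₂ hw₂ hz₂ (hlate w₂ hw₂ hz₂)
    have h8 : outSet (SimpleGraph.decideArcs B I R) z ∪ {w₁, w₂} ⊆ outSet B z := by
      intro v hv
      simp only [Finset.mem_union, Finset.mem_insert, Finset.mem_singleton] at hv
      rcases hv with hv | rfl | rfl
      · exact outSet_decideArcs_subset B I R z hv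
      · exact h4
      · exact h6
    have h9 := Finset.card_le_card h8
    rw [Finset.card_union_of_disjoint, Finset.card_pair hne] at h9
    · omega
    · rw [Finset.disjoint_right]
      intro v hv
      rcases Finset.mem_insert.1 hv with rfl | hv
      · exact h5
      · rw [Finset.mem_singleton.1 hv]; exact h7

/-- After the colour phase potentials are at most `T + r - 1` and earlier neighbours number at most
`δ`, so the descent can start once `2 * δ + 2 * r ≤ T`. At level `0` neither alternative of the
invariant is possible, hence no vertex remains. -/
theorem exists_isPartialOrientation_empty (hinj : Function.Injective π) (hG : G.Colorable r)
    [DecidableRel G.Adj]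
    (hπ : ∀ v, (Finset.univ.filter fun w => G.Adj v w ∧ π w < π v).card ≤ δ) :
    ∃ B, IsPartialOrientation G π (2 * δ + 3 * r + 1) 0 ∅ B := by
  obtain ⟨T, hT⟩ : ∃ T, T = 2 * δ + 2 * r + 1 := ⟨_, rfl⟩
  obtain ⟨X, B, h, hX⟩ :=
    exists_isPartialOrientation_of_colorable hinj hG hπ (show δ ≤ T by omega)
  rw [show T + r = 2 * δ + 3 * r + 1 by omega] at h
  have key : ∀ j ≤ T, ∃ X B, IsPartialOrientation G π (2 * δ + 3 * r + 1) (T - j) X B ∧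
      ∀ z ∈ X, (outSet B z).card < T - j ∨
      (outSet B z).card + (X.filter fun w => G.Adj z w ∧ π w < π z).card + (δ + r + 1) ≤
        2 * (T - j) := by
    intro j
    induction j with
    | zero =>
      refine fun _ => ⟨X, B, h, fun z hz => Or.inr ?_⟩
      have h1 := hX z hz
      have h2 := (Finset.card_le_card (Finset.filter_subset_filter
        (fun w => G.Adj z w ∧ π w < π z) (Finset.subset_univ X))).trans (hπ z)
      omega
    | succ j ih =>
      intro hj
      obtain ⟨X, B, h, hX⟩ := ih (by omega)
      rw [show T - j = T - (j + 1) + 1 by omega] at h hX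
      exact h.exists_descent hinj hG hπ (by omega) hX
  obtain ⟨X, B, h, hX⟩ := key T le_rfl
  rw [Nat.sub_self] at h hX
  have hempty : X = ∅ := by
    refine Finset.eq_empty_of_forall_notMem fun z hz => ?_
    have := hX z hz
    omega
  exact ⟨B, hempty ▸ h⟩

/-- The proper chromatic number is bounded linearly in terms of the degeneracy. -/
theorem properChromaticNumber_le_of_degenerate [DecidableEq V] [DecidableRel G.Adj]
    (h : ∀ S : Finset V, S.Nonempty → ∃ v ∈ S, (S.filter fun w => G.Adj v w).card ≤ δ) :
    G.properChromaticNumber ≤ ((5 * δ + 4 : ℕ) : ℕ∞) := by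
  obtain ⟨π, hinj, hπ⟩ := exists_degenerate_order G δ h
  -- With `r = δ + 1` the bound `2 * δ + 3 * r + 1` equals `5 * δ + 4`.
  obtain ⟨B, hB⟩ := exists_isPartialOrientation_empty hinj
    (colorable_of_degenerate_order G δ π hinj hπ) hπ
  let D : Digraph V := ⟨B⟩
  have hout : ∀ v, D.outdegree v = ((outSet B v).card : ℕ∞) := by
    intro v
    rw [← Set.encard_coe_eq_coe_finsetCard, Digraph.outdegree]
    congr 1
    ext w
    simp [D, mem_outSet]
  have hD : G.IsProperOrientation D := by
    refine ⟨⟨hB.adj, fun u v huv => ⟨fun h1 => hB.decided u (by simp) v h1, fun h1 =>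
      (hB.total u v huv).resolve_right h1⟩⟩, fun u v huv => ?_⟩
    rw [hout, hout]
    exact_mod_cast hB.proper u (by simp) v (by simp) huv
  refine (iInf₂_le D hD).trans (iSup_le fun v => ?_)
  rw [hout]
  have := hB.high v (by simp)
  exact_mod_cast this.trans (by omega)

end SimpleGraph

theorem mainTheorem6 :
    ∃ C : ℝ, 0 < C ∧
      ∀ (V : Type*) [Finite V] (G : SimpleGraph V) (d : ℝ),
        G.maxAverageDegree = d → Real.exp 1 < d →
          ∃ k : ℕ, G.properChromaticNumber = (k : ℕ∞) ∧
            (k : ℝ) ≤ C * (d * Real.log d / Real.log (Real.log d)) := by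
  -- Since `d > 1`, `5 * ⌊d⌋₊ + 4 ≤ 9 * d`; the factor `log d / log (log d)` is at least `1`.
  refine ⟨9, by norm_num, ?_⟩
  intro V _ G d hd hlt
  classical
  have := Fintype.ofFinite V
  have hd1 : 1 < d := (Real.add_one_le_exp 1).trans_lt' (by norm_num) |>.trans hlt
  have hd0 : 0 ≤ d := by linarith
  have hle : G.properChromaticNumber ≤ ((5 * ⌊d⌋₊ + 4 : ℕ) : ℕ∞) := by
    refine SimpleGraph.properChromaticNumber_le_of_degenerate fun S hS => ?_
    obtain ⟨v, hv, hcard⟩ := G.exists_card_adj_le_maxAverageDegree S hS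
    exact ⟨v, hv, Nat.le_floor (hd ▸ hcard)⟩
  obtain ⟨k, hk⟩ := ENat.ne_top_iff_exists.1 (ne_top_of_le_ne_top (ENat.natCast_ne_top _) hle)
  refine ⟨k, hk.symm, ?_⟩
  rw [← hk] at hle
  have hk' : (k : ℝ) ≤ 5 * (⌊d⌋₊ : ℝ) + 4 := by exact_mod_cast hle
  have hfloor := Nat.floor_le hd0
  have hlog : 1 < Real.log d := (Real.lt_log_iff_exp_lt (by linarith)).2 hlt
  have hloglog : 0 < Real.log (Real.log d) := Real.log_pos hlog
  have hratio : d ≤ d * Real.log d / Real.log (Real.log d) := by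
    rw [le_div_iff₀ hloglog]
    exact mul_le_mul_of_nonneg_left (Real.log_le_self (by linarith)) hd0
  linarith
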